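/- For a positive integer $k$ let $\pi_{2k}(x)=|\{p\le x : p \text{ and } p+2k \text{ are both prime}\}|$. Let $h=h(x)$ be a real function, positive for all large $x$, such that $h(x)=o(x/\log^2x)$ and $\log x=o(h(x))$ as $x\to\infty$. Let $m=m(x)$ be a function with positive integer values for all large $x$ (it may be constant or vary with $x$) such that $m(x)=o(h(x)/\log x)$ as $x\to\infty$. Put $M=M(x)=\lfloor h(x)/(2m(x))\rfloor$. Then $$\frac1M\sum_{1\le k\le M}\pi_{2mk}(x)\ \ge\ \frac{x}{2\log^2x}\,(1+o(1)),$$ that is, for every $\varepsilon>0$ there is an $x_\varepsilon$ such that for all real $x\ge x_\varepsilon$ $$\frac1M\sum_{1\le k\le M}\pi_{2mk}(x)\ \ge\ (1-\varepsilon)\,\frac{x}{2\log^2x}.$$ -/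

import Mathlib

/-- The prime pair counting function `π_d(x) = |{p ≤ x : p and p + d are both prime}|`. -/
noncomputable def primePairCount (d : ℕ) (x : ℝ) : ℕ :=
  ((Finset.Icc 1 ⌊x⌋₊).filter (fun p => p.Prime ∧ (p + d).Prime)).card

/-! Translate the odd primes up to `x` by `2mj` for `0 ≤ j ≤ M`. With `P` such primes this gives `(M
+ 1)P` sums, all odd and at most `x + 2mM`, so only about `x / 2` values are available.
Cauchy-Schwarz forces many coincidences `p + 2mj = p' + 2mi`; those with `i ≠ j` are prime pairs at
distance `2m|i - j|`. Hence the average of `π_{2mk}(x)` is at least about `P² / x`.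

The prime number theorem is not needed: `P ≥ c x / log x` with `c² > 1/2` suffices, and Chebyshev's
method with `(6n)! n! / ((3n)! (2n)!²)` yields `c` up to `log 108 / 6 ≈ 0.78`. -/

open Finset Filter

/-! ### Chebyshev's lower bound for the primes -/

/-- The integrality behind the Chebyshev quotient `(6n)! n! / ((3n)! (2n)! ^ 2)`, whose prime
powers are all at most `6n`. -/
theorem factorial_six_mul_dvd (n : ℕ) :
    (6 * n).factorial * n.factorial ∣
      Nat.lcmUpto (6 * n) * ((3 * n).factorial * (2 * n).factorial ^ 2) := by
  have h0 := Nat.lcmUpto_ne_zero (6 * n)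
  have hf : ∀ k : ℕ, k.factorial ≠ 0 := Nat.factorial_ne_zero
  rw [← Nat.factorization_prime_le_iff_dvd (mul_ne_zero (hf _) (hf _))
    (mul_ne_zero h0 (mul_ne_zero (hf _) (pow_ne_zero _ (hf _))))]
  intro p hp
  rw [Nat.factorization_mul (hf _) (hf _),
    Nat.factorization_mul h0 (mul_ne_zero (hf _) (pow_ne_zero _ (hf _))),
    Nat.factorization_mul (hf _) (pow_ne_zero _ (hf _)), Nat.factorization_pow]
  simp only [Finsupp.coe_add, Pi.add_apply, Finsupp.coe_smul, Pi.smul_apply, smul_eq_mul]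
  have hlog : ∀ k ≤ 6 * n, Nat.log p k < Nat.log p (6 * n) + 1 := fun k hk =>
    Nat.lt_succ_of_le (Nat.log_mono_right hk)
  rw [Nat.factorization_lcmUpto _ hp, Nat.factorization_factorial hp (hlog _ le_rfl),
    Nat.factorization_factorial hp (hlog n (by omega)),
    Nat.factorization_factorial hp (hlog (3 * n) (by omega)),
    Nat.factorization_factorial hp (hlog (2 * n) (by omega))]
  have hone : Nat.log p (6 * n) = ∑ i ∈ Ico 1 (Nat.log p (6 * n) + 1), 1 := by simp
  rw [mul_sum]
  nth_rewrite 3 [hone]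
  simp only [← sum_add_distrib]
  refine sum_le_sum fun i _ => ?_
  -- With `q = ⌊6n / p^i⌋` every floor becomes a floor of `q`, and the claim is `q + ⌊q/6⌋ ≤ 1 +
  -- ⌊q/2⌋ + 2⌊q/3⌋`.
  have h3 : 3 * n / p ^ i = 6 * n / p ^ i / 2 := by
    rw [Nat.div_div_eq_div_mul, mul_comm (p ^ i), ← Nat.div_div_eq_div_mul]; congr 1; omega
  have h2 : 2 * n / p ^ i = 6 * n / p ^ i / 3 := by
    rw [Nat.div_div_eq_div_mul, mul_comm (p ^ i), ← Nat.div_div_eq_div_mul]; congr 1; omega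
  have h1 : n / p ^ i = 6 * n / p ^ i / 6 := by
    rw [Nat.div_div_eq_div_mul, mul_comm (p ^ i), ← Nat.div_div_eq_div_mul]; congr 1; omega
  rw [h3, h2, h1]
  omega

/-- Consecutive quotients have ratio `108 (6n+1)(6n+5) / (18(n+1)(2n+1))`, slightly below 108; the
growth of `4n + 1` absorbs the deficit. -/
theorem pow_mul_factorial_le (n : ℕ) :
    108 ^ n * ((3 * n).factorial * (2 * n).factorial ^ 2) ≤
      (4 * n + 1) * ((6 * n).factorial * n.factorial) := by
  induction n with
  | zero => simp
  | succ n ih =>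
    have e6 : (6 * (n + 1)).factorial = (6 * n + 6) * ((6 * n + 5) * ((6 * n + 4) *
        ((6 * n + 3) * ((6 * n + 2) * ((6 * n + 1) * (6 * n).factorial))))) := by
      rw [show 6 * (n + 1) = 6 * n + 5 + 1 by ring]
      simp only [Nat.factorial_succ]
    have e3 : (3 * (n + 1)).factorial =
        (3 * n + 3) * ((3 * n + 2) * ((3 * n + 1) * (3 * n).factorial)) := by
      rw [show 3 * (n + 1) = 3 * n + 2 + 1 by ring]
      simp only [Nat.factorial_succ]
    have e2 : (2 * (n + 1)).factorial = (2 * n + 2) * ((2 * n + 1) * (2 * n).factorial) := by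
      rw [show 2 * (n + 1) = 2 * n + 1 + 1 by ring]
      simp only [Nat.factorial_succ]
    have key : 18 * (4 * n + 1) * (n + 1) * (2 * n + 1) ≤
        (4 * n + 5) * (6 * n + 1) * (6 * n + 5) := by nlinarith
    rw [e6, e3, e2, Nat.factorial_succ, pow_succ]
    generalize (6 * n).factorial = a at *
    generalize (3 * n).factorial = b at *
    generalize (2 * n).factorial = c at *
    generalize n.factorial = d at *
    refine Nat.le_of_mul_le_mul_left (c := 4 * n + 1) ?_ (by omega)
    calc _ = (108 ^ n * (b * c ^ 2)) * (72 * (3 * n + 1) * (3 * n + 2) * (2 * n + 1) *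
            (n + 1) ^ 2 * (18 * (4 * n + 1) * (n + 1) * (2 * n + 1))) := by ring
      _ ≤ ((4 * n + 1) * (a * d)) * (72 * (3 * n + 1) * (3 * n + 2) * (2 * n + 1) *
            (n + 1) ^ 2 * ((4 * n + 5) * (6 * n + 1) * (6 * n + 5))) := by gcongr
      _ = _ := by ring

theorem pow_le_mul_lcmUpto (n : ℕ) :
    108 ^ n ≤ (4 * n + 1) * Nat.lcmUpto (6 * n) := by
  have hpos : 0 < (3 * n).factorial * (2 * n).factorial ^ 2 := by positivity
  refine Nat.le_of_mul_le_mul_right ?_ hpos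
  calc _ ≤ _ := pow_mul_factorial_le n
    _ ≤ (4 * n + 1) * (Nat.lcmUpto (6 * n) *
          ((3 * n).factorial * (2 * n).factorial ^ 2)) := by
        refine Nat.mul_le_mul_left _ ?_
        exact Nat.le_of_dvd (Nat.mul_pos (Nat.lcmUpto_pos _) hpos) (factorial_six_mul_dvd n)
    _ = _ := by ring

theorem log_108_gt : (4.6 : ℝ) ≤ Real.log 108 := by
  rw [Real.le_log_iff_exp_le (by norm_num)]
  -- Since `4.6 = 23/5`, fifth powers reduce the claim to a decimal bound for `e`.
  have h1 : Real.exp 4.6 ^ 5 = Real.exp 1 ^ 23 := by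
    rw [← Real.exp_nat_mul, ← Real.exp_nat_mul]; norm_num
  have h2 : Real.exp 1 ^ 23 ≤ 2.7182818286 ^ 23 :=
    pow_le_pow_left₀ (Real.exp_pos 1).le Real.exp_one_lt_d9.le 23
  refine le_of_pow_le_pow_left₀ (n := 5) (by norm_num) (by norm_num) ?_
  rw [h1]
  exact h2.trans (by norm_num)

theorem psi_six_mul_ge (n : ℕ) :
    4.6 * (n : ℝ) - Real.log (4 * n + 1) ≤ Chebyshev.psi ((6 * n : ℕ) : ℝ) := by
  have h := pow_le_mul_lcmUpto n
  have h' : (108 : ℝ) ^ n ≤ (4 * n + 1) * (Nat.lcmUpto (6 * n) : ℝ) := by exact_mod_cast h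
  have hl := Real.log_le_log (by positivity) h'
  have hne : (Nat.lcmUpto (6 * n) : ℝ) ≠ 0 := by
    exact_mod_cast Nat.lcmUpto_ne_zero _
  rw [Real.log_pow, Real.log_mul (by positivity) hne, ← Chebyshev.psi_eq_log_lcmUpto] at hl
  nlinarith [log_108_gt, (Nat.cast_nonneg n : (0 : ℝ) ≤ n)]

/-- A Chebyshev lower bound for the number of primes up to `x`. -/
theorem eventually_primeCounting_ge :
    ∀ᶠ x : ℝ in atTop, 0.75 * x ≤ (Nat.primeCounting ⌊x⌋₊ : ℝ) * Real.log x := by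
  have hlog := Real.isLittleO_log_id_atTop.def (c := 0.01) (by norm_num)
  filter_upwards [hlog, eventually_ge_atTop 1000] with x hx hx1
  rw [id, Real.norm_eq_abs, Real.norm_eq_abs, abs_of_nonneg (Real.log_nonneg (by linarith)),
    abs_of_nonneg (by linarith)] at hx
  refine le_trans ?_ (Chebyshev.psi_le_primeCounting_mul_log' x)
  set n := ⌊x / 6⌋₊ with hn
  have hn1 : (n : ℝ) ≤ x / 6 := Nat.floor_le (by linarith)
  have hn2 : x / 6 < n + 1 := Nat.lt_floor_add_one _
  have hmono : Chebyshev.psi ((6 * n : ℕ) : ℝ) ≤ Chebyshev.psi x :=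
    Chebyshev.psi_mono (by push_cast; linarith)
  have hl : Real.log (4 * n + 1) ≤ Real.log x :=
    Real.log_le_log (by positivity) (by linarith)
  -- Here `4.6 / 6 > 0.766`; rounding to a multiple of 6 costs at most 4.6 and the logarithm at most
  -- `0.01 x`.
  linarith [psi_six_mul_ge n]

/-! ### Counting collisions of translates -/

/-- Cauchy-Schwarz for the fibres of a map: a lower bound for the number of collisions. -/
theorem card_sq_le_card_mul_collisions {α β : Type*} [DecidableEq β] (A : Finset α)
    (B : Finset β) (f : α → β) (hf : ∀ a ∈ A, f a ∈ B) :
    #A ^ 2 ≤ #B * ∑ a ∈ A, #{a' ∈ A | f a' = f a} := by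
  have h1 : #A = ∑ b ∈ B, #{a ∈ A | f a = b} := card_eq_sum_card_fiberwise hf
  have h2 : ∑ a ∈ A, #{a' ∈ A | f a' = f a} = ∑ b ∈ B, #{a ∈ A | f a = b} ^ 2 := by
    rw [← sum_fiberwise_of_maps_to hf]
    refine sum_congr rfl fun b _ => ?_
    rw [sum_congr rfl (g := fun _ => #{a ∈ A | f a = b}) fun a ha => by
      rw [(mem_filter.1 ha).2]]
    simp [sq]
  rw [h2, h1]
  exact sq_sum_le_card_mul_sum_sq

/-- Each distance `k ≥ 1` from `j` is attained at most once on each side; `P` is the diagonal term.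
-/
theorem sum_dist_le (Q : ℕ → ℕ) (P M j : ℕ) (hj : j ≤ M) :
    ∑ i ∈ range (M + 1), (if i = j then P else Q (Nat.dist i j)) ≤
      P + 2 * ∑ k ∈ Icc 1 M, Q k := by
  have hsplit : range (M + 1) = insert j (range j ∪ Ioc j M) := by
    ext i; simp only [mem_range, mem_insert, mem_union, mem_Ioc]; omega
  have hlow : ∑ i ∈ range j, (if i = j then P else Q (Nat.dist i j)) ≤ ∑ k ∈ Icc 1 M, Q k := by
    rw [sum_congr rfl (g := fun i => Q (j - i)) fun i hi => by
      rw [mem_range] at hi; rw [if_neg hi.ne, Nat.dist_eq_sub_of_le hi.le]]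
    rw [← sum_image (f := Q) (g := fun i => j - i)
      (fun a ha b hb h => by simp only [coe_range, Set.mem_Iio] at ha hb h; omega)]
    refine sum_le_sum_of_subset fun k hk => ?_
    obtain ⟨i, hi, rfl⟩ := mem_image.1 hk
    rw [mem_range] at hi
    rw [mem_Icc]; omega
  have hupp : ∑ i ∈ Ioc j M, (if i = j then P else Q (Nat.dist i j)) ≤ ∑ k ∈ Icc 1 M, Q k := by
    rw [sum_congr rfl (g := fun i => Q (i - j)) fun i hi => by
      rw [mem_Ioc] at hi; rw [if_neg hi.1.ne', Nat.dist_eq_sub_of_le_right hi.1.le]]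
    rw [← sum_image (f := Q) (g := fun i => i - j)
      (fun a ha b hb h => by simp only [coe_Ioc, Set.mem_Ioc] at ha hb h; omega)]
    refine sum_le_sum_of_subset fun k hk => ?_
    obtain ⟨i, hi, rfl⟩ := mem_image.1 hk
    rw [mem_Ioc] at hi
    rw [mem_Icc]; omega
  rw [hsplit, sum_insert (by simp), if_pos rfl, sum_union]
  · omega
  · rw [disjoint_left]; intro i; simp only [mem_range, mem_Ioc]; omega

/-- A finite set `S` of integers mapped by translations by multiples of `d` into `B` has many
pairs whose difference is a small multiple of `d`. -/
theorem succ_mul_card_sq_le (S B : Finset ℕ) (d M : ℕ)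
    (hB : ∀ s ∈ S, ∀ j ≤ M, s + d * j ∈ B) :
    (M + 1) * #S ^ 2 ≤ #B * (#S + 2 * ∑ k ∈ Icc 1 M, #{s ∈ S | s + d * k ∈ S}) := by
  have hcs := card_sq_le_card_mul_collisions (S ×ˢ range (M + 1)) B (fun a => a.1 + d * a.2)
    (fun a ha => by
      rw [mem_product, mem_range] at ha
      exact hB _ ha.1 _ (by omega))
  set Q : ℕ → ℕ := fun k => #{s ∈ S | s + d * k ∈ S} with hQ
  -- For fixed shifts `i ≠ j`, a collision is determined by the smaller of the two elements, and the
  -- other lies `d|i - j|` above it.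
  have hpair : ∀ j i : ℕ, ∑ s ∈ S, #{s' ∈ S | s' + d * i = s + d * j} ≤
      if i = j then #S else Q (Nat.dist i j) := by
    intro j i
    rcases lt_trichotomy i j with hij | rfl | hij
    · obtain ⟨k, rfl⟩ := Nat.exists_eq_add_of_le hij.le
      rw [if_neg hij.ne, Nat.dist_eq_sub_of_le hij.le, Nat.add_sub_cancel_left, hQ]
      dsimp only
      rw [card_filter]
      refine sum_le_sum fun s _ => ?_
      rw [filter_congr (q := fun s' => s' = s + d * k)
        (fun s' _ => by rw [mul_add]; omega), filter_eq']
      split_ifs <;> simp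
    · rw [if_pos rfl, card_eq_sum_ones]
      refine sum_le_sum fun s hs => ?_
      simp [filter_eq', hs]
    · obtain ⟨k, rfl⟩ := Nat.exists_eq_add_of_le hij.le
      rw [if_neg hij.ne', Nat.dist_eq_sub_of_le_right hij.le, Nat.add_sub_cancel_left, hQ]
      dsimp only
      simp only [card_filter]
      rw [sum_comm]
      refine sum_le_sum fun s _ => ?_
      rw [← card_filter, filter_congr (q := fun s' => s' = s + d * k)
        (fun s' _ => by rw [mul_add]; omega), filter_eq']
      split_ifs <;> simp
  have hE : ∑ a ∈ S ×ˢ range (M + 1),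
      #{a' ∈ S ×ˢ range (M + 1) | a'.1 + d * a'.2 = a.1 + d * a.2} ≤
      (M + 1) * (#S + 2 * ∑ k ∈ Icc 1 M, Q k) := by
    calc _ = ∑ j ∈ range (M + 1), ∑ i ∈ range (M + 1),
          ∑ s ∈ S, #{s' ∈ S | s' + d * i = s + d * j} := by
          simp only [card_filter, sum_product_right]
          refine sum_congr rfl fun j _ => ?_
          rw [sum_comm]
      _ ≤ ∑ j ∈ range (M + 1), (#S + 2 * ∑ k ∈ Icc 1 M, Q k) :=
          sum_le_sum fun j hj => (sum_le_sum fun i _ => hpair j i).trans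
            (sum_dist_le Q _ M j (by rw [mem_range] at hj; omega))
      _ = _ := by simp
  rw [card_product, card_range] at hcs
  refine Nat.le_of_mul_le_mul_left (c := M + 1) ?_ (by omega)
  calc _ = (#S * (M + 1)) ^ 2 := by ring
    _ ≤ _ := hcs
    _ ≤ #B * ((M + 1) * (#S + 2 * ∑ k ∈ Icc 1 M, Q k)) := Nat.mul_le_mul_left _ hE
    _ = _ := by ring

/-- The number of prime pairs whose difference is a multiple of the even number `2 * m`, bounded
below in terms of the number of odd primes. -/
theorem succ_mul_primeCounting_sq_le (x : ℝ) (m M : ℕ) :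
    (M + 1) * (Nat.primeCounting ⌊x⌋₊ - 1) ^ 2 ≤ ((⌊x⌋₊ + 2 * m * M + 1) / 2) *
      ((Nat.primeCounting ⌊x⌋₊ - 1) + 2 * ∑ k ∈ Icc 1 M, primePairCount (2 * m * k) x) := by
  set N := ⌊x⌋₊
  set S : Finset ℕ := {p ∈ Icc 1 N | p.Prime} with hS
  have hcard : #S = Nat.primeCounting N := by
    rw [← Nat.primesLE_card_eq_primeCounting]
    congr 1
    ext p
    simp only [hS, mem_filter, mem_Icc, Nat.mem_primesLE]
    exact ⟨fun h => ⟨h.1.2, h.2⟩, fun h => ⟨⟨h.2.pos, h.1⟩, h.2⟩⟩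
  obtain ⟨T, hTS, hTcard, hTodd⟩ : ∃ T ⊆ S, #T = Nat.primeCounting N - 1 ∧ ∀ p ∈ T, p % 2 = 1 := by
    by_cases h2 : 2 ∈ S
    · refine ⟨S.erase 2, erase_subset _ _, by rw [card_erase_of_mem h2, hcard], fun p hp => ?_⟩
      rw [mem_erase, hS, mem_filter] at hp
      exact (hp.2.2.eq_two_or_odd).resolve_left hp.1
    · have hempty : S = ∅ := by
        rw [eq_empty_iff_forall_notMem]
        intro p hp
        apply h2
        rw [hS, mem_filter, mem_Icc] at hp ⊢
        exact ⟨⟨by norm_num, hp.2.two_le.trans hp.1.2⟩, Nat.prime_two⟩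
      exact ⟨∅, empty_subset _, by rw [← hcard, hempty]; rfl, by simp⟩
  -- Even shifts preserve parity, so odd numbers suffice as targets; this halves `B`.
  set B : Finset ℕ := (range ((N + 2 * m * M + 1) / 2)).image fun i => 2 * i + 1 with hBdef
  have hB : ∀ s ∈ T, ∀ j ≤ M, s + 2 * m * j ∈ B := by
    intro s hs j hj
    have hsN := (mem_Icc.1 (mem_filter.1 (hTS hs)).1).2
    have hodd := hTodd s hs
    have hmj : m * j ≤ m * M := Nat.mul_le_mul_left _ hj
    rw [hBdef, mem_image]
    refine ⟨(s - 1) / 2 + m * j, ?_, ?_⟩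
    · rw [mem_range, mul_assoc]; omega
    · rw [mul_assoc]; omega
  have hBcard : #B ≤ (N + 2 * m * M + 1) / 2 := by
    simpa using card_image_le (s := range ((N + 2 * m * M + 1) / 2)) (f := fun i => 2 * i + 1)
  have h := succ_mul_card_sq_le T B (2 * m) M hB
  rw [hTcard] at h
  refine h.trans (Nat.mul_le_mul hBcard ?_)
  gcongr with k hk
  refine card_le_card fun p hp => ?_
  rw [mem_filter] at hp
  have hp1 := mem_filter.1 (hTS hp.1)
  exact mem_filter.2 ⟨hp1.1, hp1.2, (mem_filter.1 (hTS hp.2)).2⟩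

/-! ### Numerical constants and conclusion -/

theorem average_ge_of_bounds {x L M P B s : ℝ} (hx : 0 < x) (hL : 0 < L) (hM : 100 * L ≤ M)
    (hP : 0.74 * x ≤ P * L) (hB : B ≤ 0.51 * x) (hs : 0 ≤ s)
    (h : (M + 1) * P ^ 2 ≤ B * (P + 2 * s)) : x / (2 * L ^ 2) ≤ 1 / M * s := by
  have hM0 : 0 < M := by linarith
  have hP0 : 0 < P := by
    by_contra hcon
    nlinarith
  have h1 : (M + 1) * P ^ 2 ≤ 0.51 * x * (P + 2 * s) :=
    h.trans (mul_le_mul_of_nonneg_right hB (by linarith))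
  -- The diagonal term costs `0.51 x L ≤ 0.0051 x M`, which takes 0.74 down to 0.73. In the end
  -- `0.74 · 0.73 / 1.02 > 1/2`.
  have h2 : 0.73 * x * M ≤ ((M + 1) * P - 0.51 * x) * L := by
    nlinarith [mul_le_mul_of_nonneg_left hP hM0.le, mul_le_mul_of_nonneg_left hM hx.le,
      mul_pos hP0 hL]
  have h3 : (0.74 * x) * (0.73 * x * M) ≤ (P * L) * (((M + 1) * P - 0.51 * x) * L) :=
    mul_le_mul hP h2 (by positivity) (by positivity)
  have h4 : (P * L) * (((M + 1) * P - 0.51 * x) * L) ≤ x * (1.02 * s * L ^ 2) := by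
    nlinarith [mul_le_mul_of_nonneg_right h1 (sq_nonneg L)]
  have h5 : 0.54 * x * M ≤ 1.02 * s * L ^ 2 := by
    refine le_of_mul_le_mul_left (le_trans ?_ (h3.trans h4)) hx
    nlinarith [mul_pos (mul_pos hx hx) hM0]
  rw [one_div_mul_eq_div, div_le_div_iff₀ (by positivity) hM0]
  nlinarith [mul_pos hx hM0]

theorem mainTheorem7 (h : ℝ → ℝ) (m : ℝ → ℕ)
    (h_pos : ∀ᶠ x in Filter.atTop, 0 < h x)
    (m_pos : ∀ᶠ x in Filter.atTop, 0 < m x)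
    (h_upper : Asymptotics.IsLittleO Filter.atTop h (fun x : ℝ => x / Real.log x ^ 2))
    (h_lower : Asymptotics.IsLittleO Filter.atTop Real.log h)
    (m_small : Asymptotics.IsLittleO Filter.atTop (fun x : ℝ => (m x : ℝ))
      (fun x : ℝ => h x / Real.log x)) :
    ∀ ε : ℝ, 0 < ε → ∃ x₀ : ℝ, ∀ x : ℝ, x₀ ≤ x →
      (1 - ε) * (x / (2 * Real.log x ^ 2)) ≤
        (1 / (⌊h x / (2 * (m x : ℝ))⌋₊ : ℝ)) *
          ∑ k ∈ Finset.Icc 1 ⌊h x / (2 * (m x : ℝ))⌋₊,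
            (primePairCount (2 * m x * k) x : ℝ) := by
  intro ε hε
  rw [← eventually_atTop]
  -- The constant 0.01 for `h` gives `B ≤ 0.505 x + 0.5 ≤ 0.51 x`; 0.004 gives `M > 125 L - 1 ≥ 100
  -- L`; 0.01 for the logarithm pays for discarding the prime 2.
  filter_upwards [h_pos, m_pos, h_upper.def (c := 0.01) (by norm_num),
    m_small.def (c := 0.004) (by norm_num), eventually_primeCounting_ge,
    Real.isLittleO_log_id_atTop.def (c := 0.01) (by norm_num),
    Real.tendsto_log_atTop.eventually_ge_atTop 1, eventually_ge_atTop 100]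
    with x hh hm hup hsm hpi hlog hL hx
  set L := Real.log x with hLdef
  have hx0 : 0 < x := by linarith
  have hL0 : 0 < L := by linarith
  have hm0 : (0 : ℝ) < m x := by exact_mod_cast hm
  rw [Real.norm_of_nonneg hh.le, Real.norm_of_nonneg (by positivity)] at hup
  rw [Real.norm_of_nonneg hm0.le, Real.norm_of_nonneg (by positivity)] at hsm
  rw [id, Real.norm_of_nonneg hL0.le, Real.norm_of_nonneg hx0.le] at hlog
  set M := ⌊h x / (2 * (m x : ℝ))⌋₊ with hMdef
  have hMle : 2 * (m x : ℝ) * M ≤ h x := by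
    have h1 : (M : ℝ) ≤ h x / (2 * (m x : ℝ)) := Nat.floor_le (by positivity)
    rw [le_div_iff₀ (by positivity)] at h1
    linarith
  have hhx : h x ≤ 0.01 * x := by
    refine hup.trans (mul_le_mul_of_nonneg_left (div_le_self hx0.le ?_) (by norm_num))
    nlinarith
  have hMge : 100 * L ≤ M := by
    have h1 : h x / (2 * (m x : ℝ)) < M + 1 := Nat.lt_floor_add_one _
    have h2 : 125 * L ≤ h x / (2 * (m x : ℝ)) := by
      rw [le_div_iff₀ (by positivity)]
      rw [← mul_div_assoc, le_div_iff₀ hL0] at hsm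
      linarith
    linarith
  have hS0 : (0 : ℝ) ≤ ∑ k ∈ Icc 1 M, (primePairCount (2 * m x * k) x : ℝ) :=
    sum_nonneg fun _ _ => Nat.cast_nonneg _
  set c := Nat.primeCounting ⌊x⌋₊ with hc
  have hcast : (c : ℝ) - 1 ≤ ((c - 1 : ℕ) : ℝ) := by
    rw [sub_le_iff_le_add]; exact_mod_cast Nat.sub_le_iff_le_add.1 le_rfl
  have hP : 0.74 * x ≤ ((c - 1 : ℕ) : ℝ) * L := by nlinarith
  have hB : (((⌊x⌋₊ + 2 * m x * M + 1) / 2 : ℕ) : ℝ) ≤ 0.51 * x := by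
    have h1 : (((⌊x⌋₊ + 2 * m x * M + 1) / 2 : ℕ) : ℝ) ≤
        ((⌊x⌋₊ + 2 * m x * M + 1 : ℕ) : ℝ) / 2 := Nat.cast_div_le
    have h2 : (⌊x⌋₊ : ℝ) ≤ x := Nat.floor_le hx0.le
    push_cast at h1
    linarith
  have hmain := succ_mul_primeCounting_sq_le x (m x) M
  have hmainR : ((M : ℝ) + 1) * ((c - 1 : ℕ) : ℝ) ^ 2 ≤
      (((⌊x⌋₊ + 2 * m x * M + 1) / 2 : ℕ) : ℝ) * (((c - 1 : ℕ) : ℝ) +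
        2 * ∑ k ∈ Icc 1 M, (primePairCount (2 * m x * k) x : ℝ)) := by
    exact_mod_cast hmain
  -- The bound already holds with factor 1, so `1 - ε` only weakens it.
  refine le_trans ?_ (average_ge_of_bounds hx0 hL0 hMge hP hB hS0 hmainR)
  have : 0 ≤ x / (2 * L ^ 2) := by positivity
  nlinarith
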